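/- For a finite field $\mathbb{F}$, call a subset $A\subseteq\mathbb{F}$ sum-free if $A\cap(A+A)=\varnothing$, where $A+A=\{a+b: a,b\in A\}$, and closed under inverses if $0\notin A$ and $A=\{a^{-1}: a\in A\}$. Let $\mu(\mathbb{F})$ be the density $|A|/|\mathbb{F}|$ of a largest subset $A\subseteq\mathbb{F}$ that is both sum-free and closed under inverses. Then: 1. there is an absolute constant $c>0$ such that $\mu(\mathbb{F})\le 0.25-c+o(1)$ as $|\mathbb{F}|\to\infty$ over fields $\mathbb{F}$ of prime order; 2. $\mu(\mathbb{F})\ge 0.25-o(1)$ as $|\mathbb{F}|\to\infty$ over finite fields $\mathbb{F}$ of characteristic $2$; 3. consequently the limit $\lim_{|\mathbb{F}|\to\infty}\mu(\mathbb{F})$ over all finite fields does not exist, i.e. there is no real $L$ such that for every $\varepsilon>0$ there is $N$ with $|\mu(\mathbb{F})-L|<\varepsilon$ for every finite field $\mathbb{F}$ with $|\mathbb{F}|\ge N$. Here each $o(1)$ denotes a function of $|\mathbb{F}|$ alone that tends to $0$ as $|\mathbb{F}|\to\infty$. -/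

import Mathlib

universe u

namespace FiniteFieldSets

open scoped Pointwise

/-- `A` is sum-free: `A ∩ (A + A) = ∅`. -/
def IsSumFree {F : Type*} [Field F] (A : Set F) : Prop :=
  A ∩ (A + A) = ∅

/-- `A` is closed under multiplicative inverses: `0 ∉ A` and `A = {a⁻¹ : a ∈ A}`. -/
def IsInvClosed {F : Type*} [Field F] (A : Set F) : Prop :=
  (0 : F) ∉ A ∧ A = (fun a : F => a⁻¹) '' A

/-- The set of sizes of the subsets of `F` that are sum-free and closed under inverses. -/
def admissibleSizes (F : Type*) [Field F] : Set ℕ :=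
  {k | ∃ A : Set F, IsSumFree A ∧ IsInvClosed A ∧ A.ncard = k}

/-- `mu F` is the density `|A| / |F|` of a largest subset `A` of the finite field `F` that is
sum-free and closed under inverses. -/
noncomputable def mu (F : Type*) [Field F] [Finite F] : ℝ :=
  (sSup (admissibleSizes F) : ℕ) / (Nat.card F : ℝ)

/-- The supremum in the definition of `mu` is a maximum. -/
theorem isGreatest_sSup_admissibleSizes (F : Type*) [Field F] [Finite F] :
    IsGreatest (admissibleSizes F) (sSup (admissibleSizes F)) := by
  have hb : BddAbove (admissibleSizes F) := by
    refine ⟨Nat.card F, ?_⟩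
    rintro k ⟨A, -, -, rfl⟩
    exact Set.ncard_le_card A
  have hne : (admissibleSizes F).Nonempty :=
    ⟨0, ∅, by simp [IsSumFree], by simp [IsInvClosed], by simp⟩
  exact ⟨Nat.sSup_mem hne hb, fun k hk => le_csSup hb hk⟩

end FiniteFieldSets

/-!
Throughout, `ψ` is a primitive additive character of a finite field of order `q`, so that every
character is `x ↦ ψ (a x)` for a unique `a`. The analytic input is Kloosterman's bound
`|∑ ψ (a x + b x⁻¹)| = O(q ^ (3 / 4))` (`norm_kloosterman_pow_four_le`), which follows from counting
the solutions of `x + y = z + w`, `x⁻¹ + y⁻¹ = z⁻¹ + w⁻¹`. It says that `x` and `x⁻¹` behave like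
independent variables for every function whose Fourier coefficients have a bounded sum of absolute
values (`sum_units_mul_inv_le`).

In characteristic `2` the set where `ψ x = ψ x⁻¹ = -1` is sum-free and closed under inverses, and it
has density `1/4 + o(1)` (`le_mu_of_charP_two`).

In odd characteristic let `A` be sum-free. The set `A` need not be structured, but the correlation
of its indicator function with itself has Wiener norm at most `1` and vanishes on `-A`, so the
powers `(1 - corr) ^ k` are majorants of `-A` of bounded Wiener norm (`exists_wiener_majorant`).
Here `corr` counts solutions of `x + y + z = 0`, whence the sign. Carrying this out for
each of the three variables of `x + y = z` gives a weight `s` of bounded Wiener norm which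
almost contains `A` and is itself almost sum-free (`exists_wiener_container`). In odd characteristic
the nontrivial Fourier coefficients of a function with values in `[0, 1]` are at most `3/8`
(`norm_fourierCoeff_le`), which forces an almost sum-free `s` to have mean below `0.47`
(`expect_lt_of_triples_le`). If also `A = A⁻¹`, then `A` is almost contained in the weight
`s x * s x⁻¹`, whose mean is at most `0.47 ^ 2 + o(1) < 0.25 - 0.02` (`ncard_div_card_le`).
-/

open scoped BigOperators ComplexConjugate
open Finset

namespace FiniteFieldSets

/-! ### Kloosterman sums -/

section Kloosterman

variable {F : Type*} [Field F] [Fintype F] [DecidableEq F]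

/-- The Kloosterman sum `∑ ψ (a x + b x⁻¹)` over the nonzero elements `x` of the field. -/
noncomputable def kloosterman (ψ : AddChar F ℂ) (a b : F) : ℂ :=
  ∑ x : Fˣ, ψ (a * x + b * (x⁻¹ : Fˣ))

theorem sum_addChar_mul {ψ : AddChar F ℂ} (hψ : ψ.IsPrimitive) (b : F) :
    ∑ x, ψ (x * b) = if b = 0 then (Fintype.card F : ℂ) else 0 := by
  rw [AddChar.sum_mulShift b hψ]; split_ifs <;> simp

/-- Parseval's identity for the characters of `F × F`, with multiplicities: the second moment of an
exponential sum over a family of points counts the coincidences in the family. -/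
theorem sum_sum_norm_sq_eq_card {ψ : AddChar F ℂ} (hψ : ψ.IsPrimitive)
    {ι : Type*} [Fintype ι] (f g : ι → F) :
    ∑ a, ∑ b, ‖∑ i, ψ (a * f i + b * g i)‖ ^ 2 =
      (Fintype.card F : ℝ) ^ 2 * #{p : ι × ι | f p.1 = f p.2 ∧ g p.1 = g p.2} := by
  have key : ∀ a b, ((‖∑ i, ψ (a * f i + b * g i)‖ ^ 2 : ℝ) : ℂ) =
      ∑ i, ∑ j, ψ (a * (f i - f j)) * ψ (b * (g i - g j)) := by
    intro a b
    rw [Complex.ofReal_pow, ← Complex.mul_conj', map_sum, Finset.sum_mul_sum]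
    refine sum_congr rfl fun i _ => sum_congr rfl fun j _ => ?_
    rw [← AddChar.map_neg_eq_conj, ← AddChar.map_add_eq_mul, ← AddChar.map_add_eq_mul]
    congr 1; ring
  have : ((∑ a, ∑ b, ‖∑ i, ψ (a * f i + b * g i)‖ ^ 2 : ℝ) : ℂ) =
      (((Fintype.card F : ℝ) ^ 2 * #{p : ι × ι | f p.1 = f p.2 ∧ g p.1 = g p.2} : ℝ) : ℂ) := by
    push_cast
    push_cast at key
    simp_rw [key]
    calc ∑ a, ∑ b, ∑ i, ∑ j, ψ (a * (f i - f j)) * ψ (b * (g i - g j))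
        = ∑ i, ∑ j, (∑ a, ψ (a * (f i - f j))) * ∑ b, ψ (b * (g i - g j)) := by
          simp_rw [Finset.sum_mul_sum]
          rw [← Finset.sum_product' univ univ, ← Finset.sum_product' univ univ,
            Finset.sum_congr rfl (fun _ _ => (Finset.sum_product' univ univ _).symm), sum_comm]
          refine sum_congr rfl fun p _ => ?_
          rw [← Finset.sum_product' univ univ]
      _ = ∑ p : ι × ι, if f p.1 = f p.2 ∧ g p.1 = g p.2 then (Fintype.card F : ℂ) ^ 2 else 0 := by
          rw [Fintype.sum_prod_type]
          refine sum_congr rfl fun i _ => sum_congr rfl fun j _ => ?_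
          rw [sum_addChar_mul hψ, sum_addChar_mul hψ]
          simp only [sub_eq_zero]
          split_ifs <;> simp_all [sq]
      _ = _ := by
          rw [← Finset.sum_filter, Finset.sum_const, nsmul_eq_mul, mul_comm]
  exact_mod_cast this

/-- Two pairs of units with the same sum and the same sum of inverses are equal up to order, unless
both sums vanish; each of the three possibilities leaves two free units. -/
theorem card_coincidences_le :
    #{p : (Fˣ × Fˣ) × (Fˣ × Fˣ) | (p.1.1 + p.1.2 : F) = p.2.1 + p.2.2 ∧
      ((p.1.1⁻¹ : Fˣ) + (p.1.2⁻¹ : Fˣ) : F) = (p.2.1⁻¹ : Fˣ) + (p.2.2⁻¹ : Fˣ)}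
      ≤ 3 * Fintype.card Fˣ ^ 2 := by
  have hsub : ({p : (Fˣ × Fˣ) × (Fˣ × Fˣ) | (p.1.1 + p.1.2 : F) = p.2.1 + p.2.2 ∧
      ((p.1.1⁻¹ : Fˣ) + (p.1.2⁻¹ : Fˣ) : F) = (p.2.1⁻¹ : Fˣ) + (p.2.2⁻¹ : Fˣ)} : Finset _) ⊆
      (univ.image fun q : Fˣ × Fˣ => (q, q)) ∪ (univ.image fun q : Fˣ × Fˣ => (q, (q.2, q.1))) ∪
        (univ.image fun q : Fˣ × Fˣ => ((q.1, -q.1), (q.2, -q.2))) := by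
    rintro ⟨⟨x, y⟩, ⟨z, w⟩⟩ h
    simp only [mem_filter, mem_univ, true_and] at h
    obtain ⟨h1, h2⟩ := h
    simp only [mem_union, mem_image, mem_univ, true_and, Prod.mk.injEq, Prod.exists]
    have hx := x.ne_zero
    have hy := y.ne_zero
    have hz := z.ne_zero
    have hw := w.ne_zero
    by_cases hs : (x + y : F) = 0
    · right
      refine ⟨x, z, ⟨rfl, ?_⟩, rfl, ?_⟩
      · ext; push_cast; linear_combination -hs
      · ext; push_cast; linear_combination h1 - hs
    · left
      rw [Units.val_inv_eq_inv_val, Units.val_inv_eq_inv_val, Units.val_inv_eq_inv_val,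
        Units.val_inv_eq_inv_val] at h2
      have h3 : (x + y : F) * (z * w) = (x + y) * (x * y) := by
        field_simp at h2
        linear_combination h2 + (x * y : F) * (-h1)
      have h4 : (z * w : F) = x * y := mul_left_cancel₀ hs h3
      have h5 : (z - x : F) * (z - y) = 0 := by linear_combination -h4 - (z : F) * h1
      rcases mul_eq_zero.1 h5 with h | h
      · left
        refine ⟨x, y, ⟨rfl, rfl⟩, ?_, ?_⟩
        · ext; linear_combination -h
        · ext; linear_combination h1 + h
      · right
        refine ⟨x, y, ⟨rfl, rfl⟩, ?_, ?_⟩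
        · ext; linear_combination -h
        · ext; linear_combination h1 + h
  refine (card_le_card hsub).trans ((card_union_le _ _).trans ?_)
  have h := card_union_le (univ.image fun q : Fˣ × Fˣ => (q, q))
    (univ.image fun q : Fˣ × Fˣ => (q, (q.2, q.1)))
  have c : ∀ f : Fˣ × Fˣ → (Fˣ × Fˣ) × (Fˣ × Fˣ), #(univ.image f) ≤ Fintype.card Fˣ ^ 2 := by
    intro f
    refine card_image_le.trans ?_
    simp [sq]
  have c1 := c fun q => (q, q)
  have c2 := c fun q => (q, (q.2, q.1))
  have c3 := c fun q => ((q.1, -q.1), (q.2, -q.2))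
  omega

theorem kloosterman_sq (ψ : AddChar F ℂ) (a b : F) :
    kloosterman ψ a b ^ 2 =
      ∑ p : Fˣ × Fˣ, ψ (a * (p.1 + p.2) + b * ((p.1⁻¹ : Fˣ) + (p.2⁻¹ : Fˣ))) := by
  rw [kloosterman, sq, Finset.sum_mul_sum, Fintype.sum_prod_type]
  refine sum_congr rfl fun x _ => sum_congr rfl fun y _ => ?_
  rw [← AddChar.map_add_eq_mul]
  congr 1; ring

theorem sum_sum_norm_kloosterman_pow_four_le {ψ : AddChar F ℂ} (hψ : ψ.IsPrimitive) :
    ∑ a, ∑ b, ‖kloosterman ψ a b‖ ^ 4 ≤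
      3 * (Fintype.card F : ℝ) ^ 2 * (Fintype.card Fˣ : ℝ) ^ 2 := by
  have h : ∀ a b, ‖kloosterman ψ a b‖ ^ 4 =
      ‖∑ p : Fˣ × Fˣ, ψ (a * (p.1 + p.2) + b * ((p.1⁻¹ : Fˣ) + (p.2⁻¹ : Fˣ)))‖ ^ 2 := by
    intro a b
    rw [← kloosterman_sq, norm_pow, ← pow_mul]
  simp_rw [h]
  rw [sum_sum_norm_sq_eq_card hψ]
  have hc : ((#{p : (Fˣ × Fˣ) × (Fˣ × Fˣ) | (p.1.1 + p.1.2 : F) = p.2.1 + p.2.2 ∧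
      ((p.1.1⁻¹ : Fˣ) + (p.1.2⁻¹ : Fˣ) : F) = (p.2.1⁻¹ : Fˣ) + (p.2.2⁻¹ : Fˣ)} : ℕ) : ℝ)
      ≤ 3 * (Fintype.card Fˣ : ℝ) ^ 2 := by exact_mod_cast card_coincidences_le (F := F)
  calc _ ≤ (Fintype.card F : ℝ) ^ 2 * (3 * (Fintype.card Fˣ : ℝ) ^ 2) := by gcongr
    _ = _ := by ring

theorem kloosterman_mul_unit (ψ : AddChar F ℂ) (a b : F) (t : Fˣ) :
    kloosterman ψ (a * t) (b * (t⁻¹ : Fˣ)) = kloosterman ψ a b := by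
  refine Fintype.sum_equiv (Equiv.mulLeft t) _ _ fun x => ?_
  simp only [Equiv.coe_mulLeft, mul_inv, Units.val_mul]
  congr 1; ring

theorem kloosterman_zero_right {ψ : AddChar F ℂ} (hψ : ψ.IsPrimitive) {a : F} (ha : a ≠ 0) :
    kloosterman ψ a 0 = -1 := by
  have h := sum_addChar_mul hψ a
  rw [if_neg ha, ← Finset.sum_erase_add _ _ (mem_univ (0 : F)), zero_mul,
    AddChar.map_zero_eq_one] at h
  rw [← eq_neg_of_add_eq_zero_left h]
  refine Finset.sum_bij (fun (x : Fˣ) _ => (x : F)) ?_ ?_ ?_ ?_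
  · intro x _; simp
  · intro x _ y _ h; exact Units.ext h
  · intro y hy; exact ⟨Units.mk0 y (by simpa using hy), mem_univ _, rfl⟩
  · intro x _; simp [mul_comm]

theorem kloosterman_swap (ψ : AddChar F ℂ) (a b : F) :
    kloosterman ψ a b = kloosterman ψ b a := by
  refine Fintype.sum_equiv (Equiv.inv Fˣ) _ _ fun x => ?_
  simp [add_comm]

/-- Kloosterman's bound. The sum does not change when `(a, b)` moves along the hyperbola
`(a t, b t⁻¹)`, so the full fourth moment is at least `q - 1` times its fourth power. -/
theorem norm_kloosterman_pow_four_le {ψ : AddChar F ℂ} (hψ : ψ.IsPrimitive) {a b : F}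
    (hab : ¬ (a = 0 ∧ b = 0)) :
    ‖kloosterman ψ a b‖ ^ 4 ≤ 3 * (Fintype.card F : ℝ) ^ 3 := by
  have hq : (1 : ℝ) ≤ Fintype.card F := by exact_mod_cast Fintype.card_pos
  have h1 : (1 : ℝ) ≤ 3 * (Fintype.card F : ℝ) ^ 3 := by
    have := one_le_pow₀ hq (n := 3); linarith
  by_cases hb : b = 0
  · have ha : a ≠ 0 := fun h => hab ⟨h, hb⟩
    rw [hb, kloosterman_zero_right hψ ha]; simpa using h1
  by_cases ha : a = 0
  · rw [ha, kloosterman_swap, kloosterman_zero_right hψ hb]; simpa using h1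
  have hu : (0 : ℝ) < Fintype.card Fˣ := by exact_mod_cast Fintype.card_pos
  have huq : (Fintype.card Fˣ : ℝ) ≤ Fintype.card F := by
    exact_mod_cast Fintype.card_le_of_injective _ Units.val_injective
  have horbit : (Fintype.card Fˣ : ℝ) * ‖kloosterman ψ a b‖ ^ 4 ≤
      ∑ a, ∑ b, ‖kloosterman ψ a b‖ ^ 4 := by
    have hinj : Set.InjOn (fun t : Fˣ => (a * t, b * ((t⁻¹ : Fˣ) : F)))
        (univ : Finset Fˣ) := by
      intro s _ t _ h
      exact Units.ext (mul_left_cancel₀ ha (Prod.mk.inj h).1)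
    rw [← Finset.sum_product' univ univ fun a b => ‖kloosterman ψ a b‖ ^ 4]
    calc (Fintype.card Fˣ : ℝ) * ‖kloosterman ψ a b‖ ^ 4
        = ∑ t : Fˣ, ‖kloosterman ψ (a * t) (b * (t⁻¹ : Fˣ))‖ ^ 4 := by
          simp_rw [kloosterman_mul_unit]; simp
      _ = ∑ p ∈ univ.image (fun t : Fˣ => (a * t, b * ((t⁻¹ : Fˣ) : F))),
            ‖kloosterman ψ p.1 p.2‖ ^ 4 := by rw [sum_image hinj]
      _ ≤ _ := sum_le_sum_of_subset_of_nonneg (by simp) fun _ _ _ => by positivity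
  have h := horbit.trans (sum_sum_norm_kloosterman_pow_four_le hψ)
  have h' : ‖kloosterman ψ a b‖ ^ 4 ≤
      3 * (Fintype.card F : ℝ) ^ 2 * (Fintype.card Fˣ : ℝ) := by
    refine le_of_mul_le_mul_left ?_ hu
    linarith
  refine h'.trans ?_
  rw [pow_succ _ 2, ← mul_assoc]
  gcongr

/-- The form of Kloosterman's bound used below: the normalised sums are small uniformly. -/
theorem norm_kloosterman_div_card_le {ψ : AddChar F ℂ} (hψ : ψ.IsPrimitive) {a b : F}
    (hab : ¬ (a = 0 ∧ b = 0)) :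
    ‖kloosterman ψ a b‖ / Fintype.card F ≤ √√(3 / Fintype.card F) := by
  have hq : (0 : ℝ) < Fintype.card F := by exact_mod_cast Fintype.card_pos
  apply Real.le_sqrt_of_sq_le
  apply Real.le_sqrt_of_sq_le
  rw [← pow_mul, div_pow, div_le_div_iff₀ (by positivity) hq]
  have := norm_kloosterman_pow_four_le hψ hab
  calc ‖kloosterman ψ a b‖ ^ (2 * 2) * (Fintype.card F : ℝ)
      ≤ (3 * (Fintype.card F : ℝ) ^ 3) * Fintype.card F := by gcongr
    _ = _ := by ring

end Kloosterman

/-! ### Fourier coefficients and the Wiener norm -/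

section Fourier

variable {F : Type*} [Field F] [Fintype F]

/-- The Fourier coefficient of a real function `f` at the frequency `a`, that is, its mean against
the conjugate of the character `x ↦ ψ (a x)`. When `ψ` is primitive, these are all the characters
of the additive group, each occurring once. -/
noncomputable def fourierCoeff (ψ : AddChar F ℂ) (f : F → ℝ) (a : F) : ℂ :=
  𝔼 x, (f x : ℂ) * ψ (-(a * x))

/-- The Wiener norm of `f`: the sum of the absolute values of its Fourier coefficients. -/
noncomputable def wienerNorm (ψ : AddChar F ℂ) (f : F → ℝ) : ℝ :=
  ∑ a, ‖fourierCoeff ψ f a‖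

theorem wienerNorm_nonneg (ψ : AddChar F ℂ) (f : F → ℝ) : 0 ≤ wienerNorm ψ f :=
  sum_nonneg fun _ _ => norm_nonneg _

theorem fourierCoeff_zero (ψ : AddChar F ℂ) (f : F → ℝ) :
    fourierCoeff ψ f 0 = ((𝔼 x, f x : ℝ) : ℂ) := by
  simp [fourierCoeff, Complex.ofReal_expect]

theorem fourierCoeff_sub (ψ : AddChar F ℂ) (f g : F → ℝ) (a : F) :
    fourierCoeff ψ (fun x => f x - g x) a = fourierCoeff ψ f a - fourierCoeff ψ g a := by
  simp only [fourierCoeff, Complex.ofReal_sub, sub_mul, Finset.expect_sub_distrib]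

theorem fourierCoeff_neg (ψ : AddChar F ℂ) (f : F → ℝ) (a : F) :
    fourierCoeff ψ f (-a) = conj (fourierCoeff ψ f a) := by
  simp only [fourierCoeff, Fintype.expect_eq_sum_div_card, map_div₀, map_sum, map_mul,
    Complex.conj_ofReal, ← AddChar.map_neg_eq_conj]
  simp

theorem wienerNorm_sub_le (ψ : AddChar F ℂ) (f g : F → ℝ) :
    wienerNorm ψ (fun x => f x - g x) ≤ wienerNorm ψ f + wienerNorm ψ g := by
  simp_rw [wienerNorm, fourierCoeff_sub, ← sum_add_distrib]
  exact sum_le_sum fun a _ => norm_sub_le _ _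

theorem fourierCoeff_comp_neg (ψ : AddChar F ℂ) (f : F → ℝ) (a : F) :
    fourierCoeff ψ (fun x => f (-x)) a = fourierCoeff ψ f (-a) := by
  refine Fintype.expect_equiv (Equiv.neg F) _ _ fun x => ?_
  simp

theorem wienerNorm_comp_neg (ψ : AddChar F ℂ) (f : F → ℝ) :
    wienerNorm ψ (fun x => f (-x)) = wienerNorm ψ f := by
  simp_rw [wienerNorm, fourierCoeff_comp_neg]
  exact Fintype.sum_equiv (Equiv.neg F) _ _ fun _ => rfl

variable [DecidableEq F]

theorem expect_addChar_mul {ψ : AddChar F ℂ} (hψ : ψ.IsPrimitive) (b : F) :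
    𝔼 x, ψ (x * b) = if b = 0 then 1 else 0 := by
  have hq : (Fintype.card F : ℂ) ≠ 0 := by exact_mod_cast Fintype.card_ne_zero
  rw [Fintype.expect_eq_sum_div_card, sum_addChar_mul hψ]
  split_ifs <;> simp [hq]

theorem fourier_inversion {ψ : AddChar F ℂ} (hψ : ψ.IsPrimitive) (f : F → ℝ) (x : F) :
    ∑ a, fourierCoeff ψ f a * ψ (a * x) = f x := by
  have hq : (Fintype.card F : ℂ) ≠ 0 := by exact_mod_cast Fintype.card_ne_zero
  calc ∑ a, fourierCoeff ψ f a * ψ (a * x)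
      = ∑ a, 𝔼 y, (f y : ℂ) * ψ (a * (x - y)) := by
        refine sum_congr rfl fun a _ => ?_
        rw [fourierCoeff, expect_mul]
        refine expect_congr rfl fun y _ => ?_
        rw [mul_assoc, ← AddChar.map_add_eq_mul]
        congr 2; ring
    _ = 𝔼 y, (f y : ℂ) * ∑ a, ψ (a * (x - y)) := by
        rw [← expect_sum_comm]
        simp_rw [mul_sum]
    _ = f x := by
        simp_rw [sum_addChar_mul hψ, Fintype.expect_eq_sum_div_card, sub_eq_zero, mul_ite, mul_zero]
        rw [sum_ite_eq]
        simp [hq]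

theorem fourierCoeff_mul {ψ : AddChar F ℂ} (hψ : ψ.IsPrimitive) (f g : F → ℝ) (a : F) :
    fourierCoeff ψ (fun x => f x * g x) a =
      ∑ b, fourierCoeff ψ f b * fourierCoeff ψ g (a - b) := by
  calc fourierCoeff ψ (fun x => f x * g x) a
      = 𝔼 x, ∑ b, fourierCoeff ψ f b * ((g x : ℂ) * ψ (-((a - b) * x))) := by
        refine expect_congr rfl fun x _ => ?_
        rw [Complex.ofReal_mul, ← fourier_inversion hψ f x, sum_mul, sum_mul]
        refine sum_congr rfl fun b _ => ?_
        rw [show -((a - b) * x) = b * x + -(a * x) by ring, AddChar.map_add_eq_mul]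
        ring
    _ = _ := by
        rw [expect_sum_comm]
        simp_rw [fourierCoeff, mul_expect]

theorem wienerNorm_mul_le {ψ : AddChar F ℂ} (hψ : ψ.IsPrimitive) (f g : F → ℝ) :
    wienerNorm ψ (fun x => f x * g x) ≤ wienerNorm ψ f * wienerNorm ψ g := by
  calc wienerNorm ψ (fun x => f x * g x)
      ≤ ∑ a, ∑ b, ‖fourierCoeff ψ f b‖ * ‖fourierCoeff ψ g (a - b)‖ := by
        refine sum_le_sum fun a _ => ?_
        rw [fourierCoeff_mul hψ]
        exact (norm_sum_le _ _).trans (sum_le_sum fun b _ => (norm_mul _ _).le)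
    _ = ∑ b, ‖fourierCoeff ψ f b‖ * wienerNorm ψ g := by
        rw [sum_comm]
        refine sum_congr rfl fun b _ => ?_
        rw [← mul_sum, wienerNorm]
        congr 1
        exact Fintype.sum_equiv (Equiv.subRight b) _ _ fun _ => rfl
    _ = _ := by rw [← sum_mul]; rfl

theorem wienerNorm_one {ψ : AddChar F ℂ} (hψ : ψ.IsPrimitive) :
    wienerNorm ψ (fun _ => 1) = 1 := by
  have h : ∀ a, fourierCoeff ψ (fun _ => 1) a = if a = 0 then 1 else 0 := by
    intro a
    have := expect_addChar_mul hψ (-a)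
    simp only [neg_eq_zero] at this
    rw [← this]
    refine expect_congr rfl fun x _ => ?_
    rw [Complex.ofReal_one, one_mul]; congr 1; ring
  rw [wienerNorm]
  simp_rw [h]
  rw [Finset.sum_eq_single 0] <;> simp +contextual

theorem wienerNorm_pow_le {ψ : AddChar F ℂ} (hψ : ψ.IsPrimitive) (f : F → ℝ) (k : ℕ) :
    wienerNorm ψ (fun x => f x ^ k) ≤ wienerNorm ψ f ^ k := by
  induction k with
  | zero => simpa using (wienerNorm_one hψ).le
  | succ k ih =>
    simp_rw [pow_succ]
    exact (wienerNorm_mul_le hψ _ _).trans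
      (mul_le_mul_of_nonneg_right ih (wienerNorm_nonneg _ _))

theorem expect_mul_eq_sum_fourierCoeff {ψ : AddChar F ℂ} (hψ : ψ.IsPrimitive) (f g : F → ℝ) :
    ((𝔼 x, f x * g x : ℝ) : ℂ) = ∑ a, fourierCoeff ψ f a * fourierCoeff ψ g (-a) := by
  have h := fourierCoeff_mul hψ f g 0
  rw [fourierCoeff_zero] at h
  simpa using h

theorem sum_norm_fourierCoeff_sq {ψ : AddChar F ℂ} (hψ : ψ.IsPrimitive) (f : F → ℝ) :
    ∑ a, ‖fourierCoeff ψ f a‖ ^ 2 = 𝔼 x, f x ^ 2 := by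
  have h := expect_mul_eq_sum_fourierCoeff hψ f f
  simp_rw [fourierCoeff_neg, Complex.mul_conj', ← sq] at h
  exact_mod_cast h.symm

/-- In odd characteristic no function with values in `[0, 1]` correlates perfectly with a nontrivial
character. After a rotation, the coefficient is the mean of `(f - 1/2) * Re (c ψ)`, which is at most
the mean of `(Re (c ψ) ^ 2 + 1) / 4`; as `ψ ^ 2` is nontrivial, `Re (c ψ) ^ 2` has mean `1/2`. -/
theorem norm_fourierCoeff_le {ψ : AddChar F ℂ} (hψ : ψ.IsPrimitive) (h2 : (2 : F) ≠ 0)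
    {f : F → ℝ} (h0 : ∀ x, 0 ≤ f x) (h1 : ∀ x, f x ≤ 1) {a : F} (ha : a ≠ 0) :
    ‖fourierCoeff ψ f a‖ ≤ 3 / 8 := by
  obtain ⟨c, hc, hcf⟩ : ∃ c : ℂ, ‖c‖ = 1 ∧ c * fourierCoeff ψ f a = ‖fourierCoeff ψ f a‖ := by
    by_cases h : fourierCoeff ψ f a = 0
    · exact ⟨1, by simp, by simp [h]⟩
    · have hn : (‖fourierCoeff ψ f a‖ : ℂ) ≠ 0 := by simpa using h
      refine ⟨conj (fourierCoeff ψ f a) / ‖fourierCoeff ψ f a‖, ?_, ?_⟩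
      · simp [h]
      · rw [div_mul_eq_mul_div, Complex.conj_mul', sq, mul_div_cancel_right₀ _ hn]
  set u : F → ℂ := fun x => c * ψ (-(a * x)) with hu
  have hmean : 𝔼 x, u x = 0 := by
    have := expect_addChar_mul hψ (-a)
    rw [if_neg (neg_ne_zero.2 ha)] at this
    rw [hu, ← mul_expect]
    simp_rw [show ∀ x, -(a * x) = x * -a by intro x; ring]
    rw [this, mul_zero]
  have hmean2 : 𝔼 x, u x ^ 2 = 0 := by
    have := expect_addChar_mul hψ (-(2 * a))
    rw [if_neg (neg_ne_zero.2 (mul_ne_zero h2 ha))] at this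
    have e : ∀ x, u x ^ 2 = c ^ 2 * ψ (x * -(2 * a)) := by
      intro x
      rw [hu, mul_pow, ← AddChar.map_nsmul_eq_pow]
      congr 2; simp; ring
    simp_rw [e]
    rw [← mul_expect, this, mul_zero]
  have hre : ∀ v : F → ℂ, 𝔼 x, (v x).re = (𝔼 x, v x).re := by
    intro v
    rw [Fintype.expect_eq_sum_div_card, Fintype.expect_eq_sum_div_card, ← Complex.re_sum]
    have : (Fintype.card F : ℂ) = ((Fintype.card F : ℝ) : ℂ) := by simp
    rw [this, Complex.div_ofReal_re]
  have hunit : ∀ x, (u x).re ^ 2 = 1 / 2 + (u x ^ 2).re / 2 := by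
    intro x
    have hn : ‖u x‖ = 1 := by simp [hu, hc]
    have := Complex.sq_norm (u x)
    rw [hn, Complex.normSq_apply] at this
    have e : (u x ^ 2).re = (u x).re * (u x).re - (u x).im * (u x).im := by
      rw [sq, Complex.mul_re]
    rw [e]; nlinarith
  have hnorm : ‖fourierCoeff ψ f a‖ = 𝔼 x, f x * (u x).re := by
    have : ((‖fourierCoeff ψ f a‖ : ℝ) : ℂ) = 𝔼 x, (f x : ℂ) * u x := by
      rw [← hcf, fourierCoeff, mul_expect]
      refine expect_congr rfl fun x _ => ?_
      simp only [hu]; ring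
    have h := congrArg Complex.re this
    rw [← hre, Complex.ofReal_re] at h
    rw [h]
    refine expect_congr rfl fun x _ => ?_
    rw [Complex.re_ofReal_mul]
  rw [hnorm]
  calc 𝔼 x, f x * (u x).re
      ≤ 𝔼 x, (1 / 2 * (u x).re + (1 / 8 * (u x ^ 2).re + 3 / 8)) := by
        refine expect_le_expect fun x _ => ?_
        have := hunit x
        have a0 := h0 x
        have a1 := h1 x
        have hs : (f x - 1 / 2) ^ 2 ≤ 1 / 4 := by nlinarith
        nlinarith [sq_nonneg ((u x).re - 2 * (f x - 1 / 2))]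
    _ = 3 / 8 := by
        rw [expect_add_distrib, expect_add_distrib, ← mul_expect, ← mul_expect, hre,
          hre (fun x => u x ^ 2), hmean, hmean2]
        simp

end Fourier

/-! ### Correlations and their majorants -/

section Cutoff

variable {F : Type*} [Field F] [Fintype F]

/-- The mean number of representations of `-z` as `x + y`, where `x` and `y` carry the weights `u`
and `v`. -/
noncomputable def corr (u v : F → ℝ) (z : F) : ℝ :=
  𝔼 x, u x * v (-z - x)

/-- The weighted density of the solutions of `x + y + z = 0`. Placing all three variables on the
same side of the equation makes this symmetric in the weights. -/
noncomputable def triples (u v w : F → ℝ) : ℝ :=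
  𝔼 z, corr u v z * w z

theorem triples_eq (u v w : F → ℝ) :
    triples u v w = 𝔼 z, 𝔼 x, u x * v (-z - x) * w z := by
  simp_rw [triples, corr, expect_mul]

theorem corr_comm (u v : F → ℝ) : corr u v = corr v u := by
  funext z
  refine Fintype.expect_equiv (Equiv.subLeft (-z)) _ _ fun x => ?_
  simp [mul_comm]

theorem triples_comm (u v w : F → ℝ) : triples u v w = triples v u w := by
  rw [triples, corr_comm]; rfl

theorem triples_right_comm (u v w : F → ℝ) : triples u v w = triples u w v := by
  rw [triples_eq, triples_eq, expect_comm,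
    expect_comm univ univ (fun z x => u x * w (-z - x) * v z)]
  refine expect_congr rfl fun x _ => ?_
  refine Fintype.expect_equiv ((Equiv.neg F).trans (Equiv.subRight x)) _ _ fun z => ?_
  simp only [Equiv.trans_apply, Equiv.neg_apply, Equiv.subRight_apply]
  rw [show -(-z - x) - x = z by ring]; ring

theorem triples_mono {u v w u' v' w' : F → ℝ} (hu : ∀ x, 0 ≤ u x) (hv : ∀ x, 0 ≤ v x)
    (hw : ∀ x, 0 ≤ w x) (hu' : ∀ x, u x ≤ u' x) (hv' : ∀ x, v x ≤ v' x) (hw' : ∀ x, w x ≤ w' x) :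
    triples u v w ≤ triples u' v' w' := by
  rw [triples_eq, triples_eq]
  refine expect_le_expect fun z _ => expect_le_expect fun x _ => ?_
  have := (hu x).trans (hu' x)
  have := (hv (-z - x)).trans (hv' (-z - x))
  exact mul_le_mul (mul_le_mul (hu' x) (hv' _) (hv _) (by assumption)) (hw' z) (hw z)
    (by positivity)

theorem corr_nonneg {u v : F → ℝ} (hu : ∀ x, 0 ≤ u x) (hv : ∀ x, 0 ≤ v x) (z : F) :
    0 ≤ corr u v z :=
  expect_nonneg fun x _ => mul_nonneg (hu x) (hv _)

theorem corr_le_one {u v : F → ℝ} (hu : ∀ x, u x ≤ 1) (hv0 : ∀ x, 0 ≤ v x) (hv : ∀ x, v x ≤ 1)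
    (z : F) : corr u v z ≤ 1 :=
  expect_le univ_nonempty fun x _ => mul_le_one₀ (hu x) (hv0 _) (hv _)

theorem fourierCoeff_corr (ψ : AddChar F ℂ) (u v : F → ℝ) (a : F) :
    fourierCoeff ψ (corr u v) a = fourierCoeff ψ u (-a) * fourierCoeff ψ v (-a) := by
  calc fourierCoeff ψ (corr u v) a
      = 𝔼 z, 𝔼 x, ((u x : ℂ) * ψ (a * x)) * ((v (-z - x) : ℂ) * ψ (a * (-z - x))) := by
        refine expect_congr rfl fun z _ => ?_
        rw [corr, Complex.ofReal_expect, expect_mul]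
        refine expect_congr rfl fun x _ => ?_
        rw [show -(a * z) = a * x + a * (-z - x) by ring, AddChar.map_add_eq_mul]
        push_cast; ring
    _ = 𝔼 x, ((u x : ℂ) * ψ (a * x)) * 𝔼 y, (v y : ℂ) * ψ (a * y) := by
        rw [expect_comm]
        refine expect_congr rfl fun x _ => ?_
        rw [← mul_expect]
        congr 1
        refine Fintype.expect_equiv ((Equiv.neg F).trans (Equiv.subRight x)) _ _ fun z => ?_
        simp
    _ = _ := by
        rw [← expect_mul]
        simp [fourierCoeff]

variable [DecidableEq F]

/-- Correlations of bounded functions have bounded Wiener norm, by Parseval. -/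
theorem wienerNorm_corr_le_one {ψ : AddChar F ℂ} (hψ : ψ.IsPrimitive) {u v : F → ℝ}
    (hu0 : ∀ x, 0 ≤ u x) (hu : ∀ x, u x ≤ 1) (hv0 : ∀ x, 0 ≤ v x) (hv : ∀ x, v x ≤ 1) :
    wienerNorm ψ (corr u v) ≤ 1 := by
  have hsq : ∀ f : F → ℝ, (∀ x, 0 ≤ f x) → (∀ x, f x ≤ 1) →
      ∑ a, ‖fourierCoeff ψ f a‖ ^ 2 ≤ 1 := by
    intro f h0 h1
    rw [sum_norm_fourierCoeff_sq hψ]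
    exact expect_le univ_nonempty fun x _ => pow_le_one₀ (h0 x) (h1 x)
  calc wienerNorm ψ (corr u v)
      = ∑ a, ‖fourierCoeff ψ u a‖ * ‖fourierCoeff ψ v a‖ := by
        refine Fintype.sum_equiv (Equiv.neg F) _ _ fun a => ?_
        rw [fourierCoeff_corr, norm_mul]; rfl
    _ ≤ ∑ a, (‖fourierCoeff ψ u a‖ ^ 2 / 2 + ‖fourierCoeff ψ v a‖ ^ 2 / 2) :=
        sum_le_sum fun a _ => by
          nlinarith [sq_nonneg (‖fourierCoeff ψ u a‖ - ‖fourierCoeff ψ v a‖)]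
    _ ≤ 1 := by
        rw [sum_add_distrib, ← sum_div, ← sum_div]
        linarith [hsq u hu0 hu, hsq v hv0 hv]

/-- Given weights `u, v`, the function `(1 - corr u v) ^ k` is a smooth substitute for the
indicator function of the set where `corr u v` vanishes: it has bounded Wiener norm, it majorises up
to a small error every weight `w` for which `triples u v w` is small, and it still has few triples
with `u` and `v`. -/
theorem exists_wiener_majorant {ψ : AddChar F ℂ} (hψ : ψ.IsPrimitive) {u v w : F → ℝ}
    (hu0 : ∀ x, 0 ≤ u x) (hu : ∀ x, u x ≤ 1) (hv0 : ∀ x, 0 ≤ v x) (hv : ∀ x, v x ≤ 1)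
    (hw0 : ∀ x, 0 ≤ w x) {ε : ℝ} (hT : triples u v w ≤ ε) {k : ℕ} (hk : 0 < k) :
    ∃ g : F → ℝ, (∀ x, 0 ≤ g x) ∧ (∀ x, g x ≤ 1) ∧ wienerNorm ψ g ≤ 2 ^ k ∧
      𝔼 x, w x * (1 - g x) ≤ k * ε ∧ triples u v g ≤ 1 / k := by
  have hd0 := corr_nonneg hu0 hv0
  have hd1 := corr_le_one hu hv0 hv
  refine ⟨fun x => (1 - corr u v x) ^ k, fun x => pow_nonneg (sub_nonneg.2 (hd1 x)) k,
    fun x => pow_le_one₀ (sub_nonneg.2 (hd1 x)) (by linarith [hd0 x]), ?_, ?_, ?_⟩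
  · refine (wienerNorm_pow_le hψ _ k).trans (pow_le_pow_left₀ (wienerNorm_nonneg _ _) ?_ k)
    refine (wienerNorm_sub_le ψ (fun _ => 1) (corr u v)).trans ?_
    rw [wienerNorm_one hψ]
    linarith [wienerNorm_corr_le_one hψ hu0 hu hv0 hv]
  · calc 𝔼 x, w x * (1 - (1 - corr u v x) ^ k)
        ≤ 𝔼 x, k * (corr u v x * w x) := by
          refine expect_le_expect fun x _ => ?_
          have := one_add_mul_le_pow (a := -corr u v x) (by linarith [hd1 x]) k
          rw [← sub_eq_add_neg] at this
          have h : 1 - (1 - corr u v x) ^ k ≤ k * corr u v x := by linarith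
          calc w x * (1 - (1 - corr u v x) ^ k) ≤ w x * (k * corr u v x) :=
                mul_le_mul_of_nonneg_left h (hw0 x)
            _ = _ := by ring
      _ = k * triples u v w := by rw [← mul_expect]; rfl
      _ ≤ k * ε := by gcongr
  · refine expect_le univ_nonempty fun x _ => ?_
    have hk' : (0 : ℝ) < k := by exact_mod_cast hk
    rw [le_div_iff₀ hk']
    set t := corr u v x with ht
    have t0 : 0 ≤ t := hd0 x
    have t1 : t ≤ 1 := hd1 x
    have hp : 0 ≤ (1 - t) ^ k := pow_nonneg (sub_nonneg.2 t1) k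
    -- Bernoulli's inequality for `1 + t` bounds the product by `(1 - t ^ 2) ^ k`.
    calc t * (1 - t) ^ k * k ≤ (1 + k * t) * (1 - t) ^ k := by nlinarith
      _ ≤ (1 + t) ^ k * (1 - t) ^ k :=
          mul_le_mul_of_nonneg_right (one_add_mul_le_pow (by linarith) k) hp
      _ = ((1 + t) * (1 - t)) ^ k := (mul_pow _ _ _).symm
      _ ≤ 1 := pow_le_one₀ (by nlinarith) (by nlinarith)

/-- In odd characteristic a weight `s` with few solutions of `x + y = z` has mean `m` well below
`1/2`: the density of solutions differs from `m ^ 3` by at most `3/8 * (m - m ^ 2)`, since no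
nontrivial Fourier coefficient exceeds `3/8`. -/
theorem expect_lt_of_triples_le {ψ : AddChar F ℂ} (hψ : ψ.IsPrimitive) (h2 : (2 : F) ≠ 0)
    {s : F → ℝ} (h0 : ∀ x, 0 ≤ s x) (h1 : ∀ x, s x ≤ 1)
    (hT : triples s s (fun x => s (-x)) ≤ 1 / 100) : 𝔼 x, s x < 0.47 := by
  set m := 𝔼 x, s x with hm
  have m0 : 0 ≤ m := expect_nonneg fun x _ => h0 x
  have hTf : ((triples s s (fun x => s (-x)) : ℝ) : ℂ) =
      ∑ a, fourierCoeff ψ s (-a) ^ 2 * fourierCoeff ψ s a := by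
    rw [triples, expect_mul_eq_sum_fourierCoeff hψ]
    refine sum_congr rfl fun a _ => ?_
    rw [fourierCoeff_corr, fourierCoeff_comp_neg, neg_neg, sq]
  have hpars : ∑ a ∈ univ.erase 0, ‖fourierCoeff ψ s a‖ ^ 2 ≤ m - m ^ 2 := by
    have h := sum_norm_fourierCoeff_sq hψ s
    rw [← Finset.sum_erase_add _ _ (mem_univ (0 : F)), fourierCoeff_zero, ← hm] at h
    have hle : 𝔼 x, s x ^ 2 ≤ m := expect_le_expect fun x _ => by nlinarith [h0 x, h1 x]
    rw [Complex.norm_real, Real.norm_eq_abs, sq_abs] at h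
    linarith
  have hdev : ‖(triples s s (fun x => s (-x)) : ℂ) - (m : ℂ) ^ 3‖ ≤ 3 / 8 * (m - m ^ 2) := by
    rw [hTf, ← Finset.sum_erase_add _ _ (mem_univ (0 : F)), neg_zero, fourierCoeff_zero, ← hm,
      ← pow_succ, add_sub_cancel_right]
    refine (norm_sum_le _ _).trans ?_
    calc ∑ a ∈ univ.erase 0, ‖fourierCoeff ψ s (-a) ^ 2 * fourierCoeff ψ s a‖
        ≤ ∑ a ∈ univ.erase 0, 3 / 8 * ‖fourierCoeff ψ s a‖ ^ 2 := by
          refine sum_le_sum fun a ha => ?_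
          rw [norm_mul, norm_pow, fourierCoeff_neg, RCLike.norm_conj, mul_comm]
          have := norm_fourierCoeff_le hψ h2 h0 h1 (ne_of_mem_erase ha)
          gcongr
      _ ≤ _ := by rw [← mul_sum]; gcongr
  have hdev' : |triples s s (fun x => s (-x)) - m ^ 3| ≤ 3 / 8 * (m - m ^ 2) := by
    rw [← Real.norm_eq_abs, ← Complex.norm_real]; push_cast; exact hdev
  have := (abs_le.1 hdev').1
  by_contra! hcon
  have hcon' : (0.47 : ℝ) ≤ m := hcon
  have : m * (m ^ 2 + 3 / 8 * m - 3 / 8) ≤ 1 / 100 := by nlinarith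
  have h3 : 0.022 ≤ m ^ 2 + 3 / 8 * m - 3 / 8 := by nlinarith
  nlinarith

end Cutoff

/-! ### Containers for sum-free sets -/

section SumFree

open scoped Pointwise

variable {F : Type*} [Field F] [Fintype F]

theorem triples_indicator_eq_zero {A : Set F} (hA : IsSumFree A) :
    triples (A.indicator 1) (A.indicator 1) (fun x => A.indicator 1 (-x)) = 0 := by
  rw [triples_eq]
  refine expect_eq_zero fun z _ => expect_eq_zero fun x _ => ?_
  by_cases hx : x ∈ A
  · by_cases hy : -z - x ∈ A
    · by_cases hz : -z ∈ A
      · have : -z ∈ A ∩ (A + A) := ⟨hz, x, hx, -z - x, hy, by ring⟩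
        rw [IsSumFree] at hA
        rw [hA] at this
        exact absurd this (Set.notMem_empty _)
      · simp [hz]
    · simp [hy]
  · simp [hx]

variable [DecidableEq F]

/-- A sum-free set is almost contained in a weight of bounded Wiener norm that is itself almost
sum-free. The equation `x + y = z` with all three variables in `A` is relaxed one variable at a
time: each step replaces the indicator function of `A` in one place by its majorant relative to the
other two places, and `s` is the product of the three majorants. -/
theorem exists_wiener_container {ψ : AddChar F ℂ} (hψ : ψ.IsPrimitive) {A : Set F}
    (hA : IsSumFree A) {k₁ k₂ k₃ : ℕ} (hk₁ : 0 < k₁) (hk₂ : 0 < k₂) (hk₃ : 0 < k₃) :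
    ∃ s : F → ℝ, (∀ x, 0 ≤ s x) ∧ (∀ x, s x ≤ 1) ∧ wienerNorm ψ s ≤ 2 ^ (k₁ + k₂ + k₃) ∧
      𝔼 x, A.indicator 1 x * (1 - s x) ≤ (k₂ / k₁ + k₃ / k₂ : ℝ) ∧
      triples s s (fun x => s (-x)) ≤ 1 / k₃ := by
  set i : F → ℝ := A.indicator 1 with hi
  have i0 : ∀ x, 0 ≤ i x := fun x => Set.indicator_nonneg (fun _ _ => zero_le_one) x
  have i1 : ∀ x, i x ≤ 1 := fun x => Set.indicator_le_self' (fun _ _ => zero_le_one) x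
  obtain ⟨g₁, p₁, q₁, W₁, E₁, T₁⟩ := exists_wiener_majorant hψ i0 i1 i0 i1
    (w := fun x => i (-x)) (fun x => i0 (-x)) (triples_indicator_eq_zero hA).le hk₁
  rw [triples_right_comm, triples_comm] at T₁
  obtain ⟨g₂, p₂, q₂, W₂, E₂, T₂⟩ := exists_wiener_majorant hψ p₁ q₁ i0 i1 i0 T₁ hk₂
  rw [triples_right_comm] at T₂
  obtain ⟨g₃, p₃, q₃, W₃, E₃, T₃⟩ := exists_wiener_majorant hψ p₁ q₁ p₂ q₂ i0 T₂ hk₃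
  rw [triples_comm, triples_right_comm] at T₃
  have E₁' : 𝔼 x, i x * (1 - g₁ (-x)) ≤ 0 := by
    rw [mul_zero] at E₁
    refine le_of_eq_of_le (Fintype.expect_equiv (Equiv.neg F) _ _ fun x => ?_) E₁
    simp
  have s0 : ∀ x, 0 ≤ g₁ (-x) * g₂ x * g₃ x := fun x =>
    mul_nonneg (mul_nonneg (p₁ _) (p₂ x)) (p₃ x)
  have le1 : ∀ x, g₁ (-x) * g₂ x * g₃ x ≤ g₁ (-x) := fun x => by
    rw [mul_assoc]
    exact mul_le_of_le_one_right (p₁ _) (mul_le_one₀ (q₂ x) (p₃ x) (q₃ x))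
  have le2 : ∀ x, g₁ (-x) * g₂ x * g₃ x ≤ g₂ x := fun x => by
    rw [mul_right_comm]
    exact mul_le_of_le_one_left (p₂ _) (mul_le_one₀ (q₁ _) (p₃ x) (q₃ x))
  have le3 : ∀ x, g₁ (-x) * g₂ x * g₃ x ≤ g₃ x := fun x =>
    mul_le_of_le_one_left (p₃ _) (mul_le_one₀ (q₁ _) (p₂ x) (q₂ x))
  refine ⟨fun x => g₁ (-x) * g₂ x * g₃ x, s0, fun x => (le1 x).trans (q₁ _), ?_, ?_, ?_⟩
  · calc _ ≤ wienerNorm ψ (fun x => g₁ (-x) * g₂ x) * wienerNorm ψ g₃ := wienerNorm_mul_le hψ _ _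
      _ ≤ wienerNorm ψ (fun x => g₁ (-x)) * wienerNorm ψ g₂ * wienerNorm ψ g₃ :=
          mul_le_mul_of_nonneg_right (wienerNorm_mul_le hψ _ _) (wienerNorm_nonneg _ _)
      _ ≤ 2 ^ k₁ * 2 ^ k₂ * 2 ^ k₃ := by
          rw [wienerNorm_comp_neg]
          have := wienerNorm_nonneg ψ g₁
          have := wienerNorm_nonneg ψ g₂
          have := wienerNorm_nonneg ψ g₃
          gcongr
      _ = _ := by rw [pow_add, pow_add]
  · calc 𝔼 x, i x * (1 - g₁ (-x) * g₂ x * g₃ x)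
        ≤ 𝔼 x, (i x * (1 - g₁ (-x)) + i x * (1 - g₂ x) + i x * (1 - g₃ x)) := by
          refine expect_le_expect fun x _ => ?_
          rw [← mul_add, ← mul_add]
          refine mul_le_mul_of_nonneg_left ?_ (i0 x)
          have a := mul_nonneg (sub_nonneg.2 (q₁ (-x))) (sub_nonneg.2 (q₂ x))
          have b := mul_nonneg (sub_nonneg.2 (mul_le_one₀ (q₁ (-x)) (p₂ x) (q₂ x)))
            (sub_nonneg.2 (q₃ x))
          nlinarith
      _ ≤ 0 + k₂ * (1 / k₁) + k₃ * (1 / k₂) := by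
          rw [expect_add_distrib, expect_add_distrib]
          gcongr
      _ = _ := by ring
  · refine (triples_mono s0 s0 (fun x => s0 (-x)) le2 le3 fun x => ?_).trans T₃
    simpa using le1 (-x)

end SumFree

/-! ### Sets closed under inverses -/

section Density

theorem sum_indicator_one {α : Type*} [Fintype α] (A : Set α) :
    ∑ x, A.indicator (1 : α → ℝ) x = A.ncard := by
  classical
  simp [Set.indicator_apply, Set.ncard_eq_toFinset_card']

variable {F : Type*} [Field F] [Fintype F] [DecidableEq F]

theorem sum_units_eq_sum_kloosterman {ψ : AddChar F ℂ} (hψ : ψ.IsPrimitive) (s : F → ℝ) :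
    ((∑ x : Fˣ, s x * s (x⁻¹ : Fˣ) : ℝ) : ℂ) =
      ∑ p : F × F, fourierCoeff ψ s p.1 * fourierCoeff ψ s p.2 * kloosterman ψ p.1 p.2 := by
  rw [Complex.ofReal_sum]
  simp_rw [Complex.ofReal_mul, kloosterman, mul_sum]
  rw [sum_comm]
  refine sum_congr rfl fun x _ => ?_
  rw [← fourier_inversion hψ s x, ← fourier_inversion hψ s (x⁻¹ : Fˣ), Finset.sum_mul_sum,
    Fintype.sum_prod_type]
  refine sum_congr rfl fun a _ => sum_congr rfl fun b _ => ?_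
  rw [AddChar.map_add_eq_mul]; ring

/-- Inversion acts as an independent copy of the variable on functions of bounded Wiener norm: by
Kloosterman's bound, the mean of `s x * s x⁻¹` is essentially the square of the mean of `s`. -/
theorem sum_units_mul_inv_le {ψ : AddChar F ℂ} (hψ : ψ.IsPrimitive) (s : F → ℝ) :
    (∑ x : Fˣ, s x * s (x⁻¹ : Fˣ)) / Fintype.card F ≤
      (𝔼 x, s x) ^ 2 + wienerNorm ψ s ^ 2 * √√(3 / Fintype.card F) := by
  have hq : (0 : ℝ) < Fintype.card F := by exact_mod_cast Fintype.card_pos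
  have hK0 : ‖kloosterman ψ (0 : F) 0‖ ≤ Fintype.card F := by
    simp only [kloosterman, zero_mul, add_zero, AddChar.map_zero_eq_one, sum_const, card_univ,
      nsmul_eq_mul, mul_one, Complex.norm_natCast]
    exact_mod_cast Fintype.card_le_of_injective _ Units.val_injective
  have h1 : ∑ x : Fˣ, s x * s (x⁻¹ : Fˣ) ≤
      ∑ p : F × F, ‖fourierCoeff ψ s p.1‖ * ‖fourierCoeff ψ s p.2‖ * ‖kloosterman ψ p.1 p.2‖ := by
    refine (le_abs_self _).trans ?_
    rw [← Real.norm_eq_abs, ← Complex.norm_real, sum_units_eq_sum_kloosterman hψ]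
    refine (norm_sum_le _ _).trans (sum_le_sum fun p _ => ?_)
    rw [norm_mul, norm_mul]
  have h2 : ∑ p ∈ univ.erase (0 : F × F),
        ‖fourierCoeff ψ s p.1‖ * ‖fourierCoeff ψ s p.2‖ * ‖kloosterman ψ p.1 p.2‖ ≤
      wienerNorm ψ s ^ 2 * (√√(3 / Fintype.card F) * Fintype.card F) := by
    calc _ ≤ ∑ p ∈ univ.erase (0 : F × F), ‖fourierCoeff ψ s p.1‖ * ‖fourierCoeff ψ s p.2‖ *
            (√√(3 / Fintype.card F) * Fintype.card F) := by
          refine sum_le_sum fun p hp => ?_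
          have := norm_kloosterman_div_card_le hψ (a := p.1) (b := p.2)
            fun h => ne_of_mem_erase hp (Prod.ext h.1 h.2)
          rw [div_le_iff₀ hq] at this
          gcongr
      _ ≤ ∑ p : F × F, ‖fourierCoeff ψ s p.1‖ * ‖fourierCoeff ψ s p.2‖ *
            (√√(3 / Fintype.card F) * Fintype.card F) :=
          sum_le_sum_of_subset_of_nonneg (erase_subset _ _) fun _ _ _ => by positivity
      _ = _ := by
          rw [← sum_mul, Fintype.sum_prod_type, sq, wienerNorm, Finset.sum_mul_sum]
  rw [← Finset.sum_erase_add _ _ (mem_univ (0 : F × F))] at h1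
  simp only [Prod.fst_zero, Prod.snd_zero, fourierCoeff_zero, Complex.norm_real,
    Real.norm_eq_abs] at h1
  rw [div_le_iff₀ hq, add_mul, mul_assoc]
  have h3 : |𝔼 x, s x| * |𝔼 x, s x| * ‖kloosterman ψ (0 : F) 0‖ ≤
      (𝔼 x, s x) ^ 2 * Fintype.card F := by
    rw [abs_mul_abs_self, ← sq]
    gcongr
  linarith

/-- For every nonzero `x` of a set closed under inverses, either `s x * s x⁻¹` is close to `1`, or
one of `x` and `x⁻¹` is poorly covered by `s`. -/
theorem ncard_div_card_le {ψ : AddChar F ℂ} (hψ : ψ.IsPrimitive) {A : Set F}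
    (hA : IsInvClosed A) {s : F → ℝ} (h0 : ∀ x, 0 ≤ s x) (h1 : ∀ x, s x ≤ 1) :
    (A.ncard : ℝ) / Fintype.card F ≤
      (𝔼 x, s x) ^ 2 + wienerNorm ψ s ^ 2 * √√(3 / Fintype.card F) +
        2 * 𝔼 x, A.indicator 1 x * (1 - s x) := by
  have hq : (0 : ℝ) < Fintype.card F := by exact_mod_cast Fintype.card_pos
  set i : F → ℝ := A.indicator 1 with hi
  have i0 : ∀ x, 0 ≤ i x := fun x => Set.indicator_nonneg (fun _ _ => zero_le_one) x
  have hunits : ∀ f : F → ℝ, ∑ x : Fˣ, f x = ∑ x ∈ univ.erase 0, f x := by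
    intro f
    refine Finset.sum_bij (fun (x : Fˣ) _ => (x : F)) ?_ ?_ ?_ ?_
    · intro x _; simp
    · intro x _ y _ h; exact Units.ext h
    · intro y hy; exact ⟨Units.mk0 y (by simpa using hy), mem_univ _, rfl⟩
    · intro x _; rfl
  have hinv : ∀ x ∈ A, x⁻¹ ∈ A := fun x hx => by
    rw [hA.2]; exact ⟨x, hx, rfl⟩
  have hcard : ∑ x : Fˣ, i x = A.ncard := by
    rw [hunits, ← sum_indicator_one, ← Finset.sum_erase_add univ _ (mem_univ (0 : F))]
    simp [hi, hA.1]
  have herr : ∑ x : Fˣ, i x * (1 - s x) ≤ Fintype.card F * 𝔼 x, i x * (1 - s x) := by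
    rw [Fintype.card_mul_expect, hunits fun x => i x * (1 - s x)]
    exact sum_le_sum_of_subset_of_nonneg (erase_subset _ _)
      fun x _ _ => mul_nonneg (i0 x) (sub_nonneg.2 (h1 x))
  have herr' : ∑ x : Fˣ, i (x⁻¹ : Fˣ) * (1 - s (x⁻¹ : Fˣ)) ≤
      Fintype.card F * 𝔼 x, i x * (1 - s x) :=
    le_of_eq_of_le (Fintype.sum_equiv (Equiv.inv Fˣ) _ _ fun _ => rfl) herr
  have hpt : ∀ x : Fˣ, i x ≤ s x * s (x⁻¹ : Fˣ) + i x * (1 - s x) +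
      i (x⁻¹ : Fˣ) * (1 - s (x⁻¹ : Fˣ)) := by
    intro x
    have hx0 := mul_nonneg (h0 x) (h0 (x⁻¹ : Fˣ))
    by_cases hx : (x : F) ∈ A
    · have hx' : ((x⁻¹ : Fˣ) : F) ∈ A := by
        rw [Units.val_inv_eq_inv_val]; exact hinv _ hx
      simp only [hi, Set.indicator_of_mem hx, Set.indicator_of_mem hx', Pi.one_apply]
      nlinarith [mul_nonneg (sub_nonneg.2 (h1 x)) (sub_nonneg.2 (h1 (x⁻¹ : Fˣ)))]
    · have e : i x = 0 := Set.indicator_of_notMem hx _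
      have := mul_nonneg (i0 (x⁻¹ : Fˣ)) (sub_nonneg.2 (h1 (x⁻¹ : Fˣ)))
      rw [e]; linarith
  have hsum := sum_le_sum fun (x : Fˣ) (_ : x ∈ univ) => hpt x
  rw [sum_add_distrib, sum_add_distrib, hcard] at hsum
  have hmain := sum_units_mul_inv_le hψ s
  rw [div_le_iff₀ hq] at hmain ⊢
  linarith

theorem exists_isPrimitive_addChar (F : Type*) [Field F] [Finite F] :
    ∃ ψ : AddChar F ℂ, ψ.IsPrimitive :=
  ⟨AddChar.FiniteField.primitiveChar_to_Complex F,
    AddChar.FiniteField.primitiveChar_to_Complex_isPrimitive F⟩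

theorem tendsto_kloosterman_error (C : ℝ) :
    Filter.Tendsto (fun n : ℕ => C * √√(3 / (n : ℝ))) Filter.atTop (nhds 0) := by
  have h := (tendsto_const_div_atTop_nhds_zero_nat (3 : ℝ)).sqrt.sqrt.const_mul C
  simpa using h

end Density

/-! ### Bounds for the density -/

theorem mu_le_one (F : Type*) [Field F] [Finite F] : mu F ≤ 1 := by
  obtain ⟨A, -, -, hA⟩ := (isGreatest_sSup_admissibleSizes F).1
  rw [mu, ← hA]
  refine div_le_one_of_le₀ ?_ (by positivity)
  exact_mod_cast Set.ncard_le_card A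

/-- The upper bound holds in every odd characteristic, not only in prime fields. -/
theorem exists_mu_le_of_two_ne_zero :
    ∃ C : ℝ, 1 ≤ C ∧ ∀ (F : Type u) [Field F] [Finite F], (2 : F) ≠ 0 →
      mu F ≤ 0.23 + C * √√(3 / (Nat.card F : ℝ)) := by
  -- The numbers are left opaque, since `2 ^ k` is too large to be evaluated.
  obtain ⟨k₃, hk₃, h₃⟩ : ∃ n : ℕ, 0 < n ∧ (1 / n : ℝ) ≤ 1 / 100 := ⟨100, by norm_num, by norm_num⟩
  have hex : ∀ k : ℕ, ∃ n : ℕ, 0 < n ∧ (k / n : ℝ) ≤ 1 / 1000 := by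
    intro k
    refine ⟨1000 * k + 1, by omega, ?_⟩
    rw [div_le_div_iff₀ (by positivity) (by norm_num)]
    push_cast; linarith
  obtain ⟨k₂, hk₂, h₂⟩ := hex k₃
  obtain ⟨k₁, hk₁, h₁⟩ := hex k₂
  refine ⟨(2 ^ (k₁ + k₂ + k₃)) ^ 2, one_le_pow₀ (one_le_pow₀ one_le_two), ?_⟩
  intro F _ _ hF
  classical
  have := Fintype.ofFinite F
  obtain ⟨ψ, hψ⟩ := exists_isPrimitive_addChar F
  obtain ⟨A, hsf, hinv, hA⟩ := (isGreatest_sSup_admissibleSizes F).1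
  obtain ⟨s, s0, s1, hW, hE, hT⟩ := exists_wiener_container hψ hsf hk₁ hk₂ hk₃
  have hm := expect_lt_of_triples_le hψ hF s0 s1 (hT.trans h₃)
  have hm0 : 0 ≤ 𝔼 x, s x := expect_nonneg fun x _ => s0 x
  have h := ncard_div_card_le hψ hinv s0 s1
  rw [mu, ← hA, Nat.card_eq_fintype_card]
  have hW2 : wienerNorm ψ s ^ 2 * √√(3 / (Fintype.card F : ℝ)) ≤
      (2 ^ (k₁ + k₂ + k₃)) ^ 2 * √√(3 / (Fintype.card F : ℝ)) := by
    have := wienerNorm_nonneg ψ s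
    gcongr
  have hm2 : (𝔼 x, s x) ^ 2 ≤ 0.2209 := by nlinarith
  linarith

theorem exists_mu_le_of_card_prime :
    ∃ c : ℝ, 0 < c ∧ ∃ e : ℕ → ℝ, Filter.Tendsto e Filter.atTop (nhds 0) ∧
      ∀ (F : Type u) [Field F] [Finite F], (Nat.card F).Prime →
        mu F ≤ 0.25 - c + e (Nat.card F) := by
  obtain ⟨C, hC, h⟩ := exists_mu_le_of_two_ne_zero.{u}
  refine ⟨0.02, by norm_num, _, tendsto_kloosterman_error C, ?_⟩
  intro F _ _ hF
  by_cases h2 : (2 : F) = 0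
  · -- The only such field has two elements, and there the error term exceeds `1`.
    have hcard : Nat.card F = 2 := by
      have hdvd : addOrderOf (1 : F) ∣ Nat.card F := addOrderOf_dvd_natCard 1
      have hord : addOrderOf (1 : F) ∣ 2 := addOrderOf_dvd_of_nsmul_eq_zero (by simpa using h2)
      rcases (Nat.dvd_prime Nat.prime_two).1 hord with h1 | h1
      · exact absurd (AddMonoid.addOrderOf_eq_one_iff.1 h1) one_ne_zero
      · rw [h1] at hdvd
        exact ((Nat.prime_dvd_prime_iff_eq Nat.prime_two hF).1 hdvd).symm
    have h1 : 1 ≤ √√(3 / (Nat.card F : ℝ)) := by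
      rw [hcard]
      apply Real.le_sqrt_of_sq_le
      apply Real.le_sqrt_of_sq_le
      norm_num
    have := mu_le_one F
    nlinarith
  · have := h F h2
    linarith

/-- In characteristic `2` a character takes only the values `1` and `-1`, so the set where it takes
the value `-1` is sum-free; its intersection with the set of inverses is counted by a Kloosterman
sum. -/
theorem le_mu_of_charP_two (F : Type*) [Field F] [Finite F] [CharP F 2] :
    0.25 - √√(3 / (Nat.card F : ℝ)) ≤ mu F := by
  classical
  have := Fintype.ofFinite F
  obtain ⟨ψ, hψ⟩ := exists_isPrimitive_addChar F
  have hq : (0 : ℝ) < Fintype.card F := by exact_mod_cast Fintype.card_pos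
  have hval : ∀ x, ψ x = 1 ∨ ψ x = -1 := by
    intro x
    rw [← sq_eq_one_iff, sq, ← AddChar.map_add_eq_mul, CharTwo.add_self_eq_zero,
      AddChar.map_zero_eq_one]
  set A : Set F := {x | x ≠ 0 ∧ ψ x = -1 ∧ ψ x⁻¹ = -1} with hAdef
  have hsf : IsSumFree A := by
    rw [IsSumFree, Set.eq_empty_iff_forall_notMem]
    rintro x ⟨hx, a, ha, b, hb, hab⟩
    have h : ψ x = 1 := by
      rw [← hab]
      simp only [AddChar.map_add_eq_mul]
      rw [ha.2.1, hb.2.1]; norm_num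
    rw [hx.2.1] at h
    norm_num at h
  have hmem : ∀ x ∈ A, x⁻¹ ∈ A := fun x hx =>
    ⟨inv_ne_zero hx.1, hx.2.2, by rw [inv_inv]; exact hx.2.1⟩
  have hinv : IsInvClosed A := by
    refine ⟨fun h => h.1 rfl, Set.Subset.antisymm (fun x hx => ⟨x⁻¹, hmem x hx, inv_inv x⟩) ?_⟩
    rintro _ ⟨x, hx, rfl⟩
    exact hmem x hx
  have hcount : (4 * A.ncard : ℂ) = Fintype.card F + 1 + kloosterman ψ 1 1 := by
    have h0 := kloosterman_zero_right hψ (one_ne_zero (α := F))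
    have h1 := kloosterman_zero_right hψ (one_ne_zero (α := F))
    rw [kloosterman_swap] at h1
    have hu : (Fintype.card Fˣ : ℂ) = Fintype.card F - 1 := by
      rw [Fintype.card_units, Nat.cast_sub Fintype.card_pos, Nat.cast_one]
    have hA : (A.ncard : ℂ) = ∑ x : Fˣ, if (x : F) ∈ A then 1 else 0 := by
      rw [Finset.sum_boole, Set.ncard_eq_toFinset_card']
      congr 1
      symm
      refine Finset.card_bij (fun (x : Fˣ) _ => (x : F)) ?_ ?_ ?_
      · intro x hx; simpa using hx
      · intro x _ y _ h; exact Units.ext h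
      · intro y hy
        have hy' : y ∈ A := by simpa using hy
        exact ⟨Units.mk0 y hy'.1, by simpa using hy', rfl⟩
    have hx : ∀ x : Fˣ, (4 * if (x : F) ∈ A then 1 else 0 : ℂ) =
        1 - ψ (1 * x + 0 * (x⁻¹ : Fˣ)) - ψ (0 * x + 1 * (x⁻¹ : Fˣ)) +
          ψ (1 * x + 1 * (x⁻¹ : Fˣ)) := by
      intro x
      have hxA : (x : F) ∈ A ↔ ψ x = -1 ∧ ψ (x⁻¹ : Fˣ) = -1 := by
        rw [Units.val_inv_eq_inv_val]; simp [hAdef]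
      simp only [hxA, one_mul, zero_mul, add_zero, zero_add, AddChar.map_add_eq_mul]
      rcases hval x with h | h <;> rcases hval (x⁻¹ : Fˣ) with h' | h' <;> rw [h, h'] <;> norm_num
    rw [hA, mul_sum, sum_congr rfl fun x _ => hx x, sum_add_distrib, sum_sub_distrib,
      sum_sub_distrib]
    rw [kloosterman] at h0 h1 ⊢
    rw [h0, h1, sum_const, card_univ, nsmul_eq_mul, hu]
    ring
  have hlow : (Fintype.card F : ℝ) + 1 - ‖kloosterman ψ (1 : F) 1‖ ≤ 4 * A.ncard := by
    have h := congrArg Complex.re hcount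
    have hre := Complex.abs_re_le_norm (kloosterman ψ (1 : F) 1)
    have := (abs_le.1 hre).1
    have e : (4 * (A.ncard : ℂ)).re = 4 * A.ncard := by
      rw [show (4 * (A.ncard : ℂ)) = ((4 * A.ncard : ℝ) : ℂ) by push_cast; rfl, Complex.ofReal_re]
    rw [e] at h
    simp only [Complex.add_re, Complex.natCast_re, Complex.one_re] at h
    linarith
  have hK := norm_kloosterman_div_card_le hψ (a := (1 : F)) (b := 1) (by simp)
  have hle : (A.ncard : ℝ) / Fintype.card F ≤ mu F := by
    rw [mu, Nat.card_eq_fintype_card]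
    gcongr
    exact (isGreatest_sSup_admissibleSizes F).2 ⟨A, hsf, hinv, rfl⟩
  refine le_trans ?_ hle
  rw [Nat.card_eq_fintype_card, le_div_iff₀ hq]
  rw [div_le_iff₀ hq] at hK
  have := Real.sqrt_nonneg √(3 / (Fintype.card F : ℝ))
  nlinarith

/-- Prime fields and fields of characteristic `2` of arbitrarily large order both exist, and on them
the densities stay apart. -/
theorem not_exists_limit_mu {c : ℝ} (hc : 0 < c) {e e' : ℕ → ℝ}
    (he : Filter.Tendsto e Filter.atTop (nhds 0)) (he' : Filter.Tendsto e' Filter.atTop (nhds 0))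
    (hp : ∀ (F : Type u) [Field F] [Finite F], (Nat.card F).Prime →
      mu F ≤ 0.25 - c + e (Nat.card F))
    (h2 : ∀ (F : Type u) [Field F] [Finite F] [CharP F 2],
      0.25 - e' (Nat.card F) ≤ mu F) :
    ¬ ∃ L : ℝ, ∀ ε : ℝ, 0 < ε → ∃ N : ℕ, ∀ (F : Type u) [Field F] [Finite F],
      N ≤ Nat.card F → |mu F - L| < ε := by
  rintro ⟨L, hL⟩
  have hc8 : 0 < c / 8 := by linarith
  obtain ⟨N, hN⟩ := hL (c / 8) hc8
  obtain ⟨N₁, hN₁⟩ := Filter.eventually_atTop.1 (he.eventually_lt_const hc8)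
  obtain ⟨N₂, hN₂⟩ := Filter.eventually_atTop.1 (he'.eventually_lt_const hc8)
  obtain ⟨p, hpN, hpp⟩ := Nat.exists_infinite_primes (max N N₁)
  have : Fact p.Prime := ⟨hpp⟩
  have hcp : Nat.card (ULift.{u} (ZMod p)) = p := by simp
  have a1 := hp (ULift.{u} (ZMod p)) (by rw [hcp]; exact hpp)
  have a2 := hN (ULift.{u} (ZMod p)) (by rw [hcp]; exact (le_max_left _ _).trans hpN)
  have a3 := hN₁ p ((le_max_right _ _).trans hpN)
  rw [hcp] at a1
  set n := max N N₂ + 1 with hn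
  have hcn : Nat.card (ULift.{u} (GaloisField 2 n)) = 2 ^ n := by
    rw [Nat.card_congr Equiv.ulift, GaloisField.card 2 n (by omega)]
  have hle : n ≤ 2 ^ n := Nat.lt_two_pow_self.le
  have : CharP (ULift.{u} (GaloisField 2 n)) 2 :=
    charP_of_injective_ringHom
      (f := ((ULift.ringEquiv (R := GaloisField 2 n)).symm : GaloisField 2 n →+* _))
      (ULift.ringEquiv (R := GaloisField 2 n)).symm.injective 2
  have b1 := h2 (ULift.{u} (GaloisField 2 n))
  have b2 := hN (ULift.{u} (GaloisField 2 n)) (by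
    rw [hcn]; exact ((le_max_left _ _).trans (Nat.le_succ _)).trans hle)
  have b3 := hN₂ (2 ^ n) (((le_max_right _ _).trans (Nat.le_succ _)).trans hle)
  rw [hcn] at b1
  have a4 := (abs_lt.1 a2).1
  have b4 := (abs_lt.1 b2).2
  linarith

end FiniteFieldSets

theorem mainTheorem3 :
    (∃ c : ℝ, 0 < c ∧ ∃ e : ℕ → ℝ, Filter.Tendsto e Filter.atTop (nhds 0) ∧
      ∀ (F : Type u) [Field F] [Finite F], (Nat.card F).Prime →
        FiniteFieldSets.mu F ≤ 0.25 - c + e (Nat.card F)) ∧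
    (∃ e : ℕ → ℝ, Filter.Tendsto e Filter.atTop (nhds 0) ∧
      ∀ (F : Type u) [Field F] [Finite F] [CharP F 2],
        0.25 - e (Nat.card F) ≤ FiniteFieldSets.mu F) ∧
    ¬ ∃ L : ℝ, ∀ ε : ℝ, 0 < ε → ∃ N : ℕ, ∀ (F : Type u) [Field F] [Finite F],
      N ≤ Nat.card F → |FiniteFieldSets.mu F - L| < ε := by
  obtain ⟨c, hc, e, he, hp⟩ := FiniteFieldSets.exists_mu_le_of_card_prime.{u}
  have he' := FiniteFieldSets.tendsto_kloosterman_error 1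
  have h2 : ∀ (F : Type u) [Field F] [Finite F] [CharP F 2],
      0.25 - 1 * √√(3 / (Nat.card F : ℝ)) ≤ FiniteFieldSets.mu F := by
    intro F _ _ _
    rw [one_mul]
    exact FiniteFieldSets.le_mu_of_charP_two F
  exact ⟨⟨c, hc, e, he, hp⟩, ⟨_, he', h2⟩, FiniteFieldSets.not_exists_limit_mu hc he he' hp h2⟩
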